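/- Let $Q$ be a finite-dimensional smooth manifold and $L\colon TQ\to\mathbf R$ a smooth function (lagrangian). For a map between vector bundles over $Q$ that preserves the fibres, $D$ denotes the fibre derivative, i.e. the ordinary derivative along the fibres. Let $\mathcal F = DL\colon TQ\to T^*Q$ be the Legendre map, $W = D\mathcal F\colon TQ\to \mathrm{Hom}(TQ,T^*Q)$ the fibre hessian and $E(v)=\langle DL(v),v\rangle - L(v)$ the energy. For a smooth function $h$ on an open set $U\subset T^*Q$, its fibre derivatives are regarded as maps $Dh\colon U\to TQ$ and $D^2h\colon U\to\mathrm{Hom}(T^*Q,TQ)$ through the identification $T^{**}Q\cong TQ$, and $\gamma_h = Dh\circ\mathcal F\colon \mathcal F^{-1}(U)\to TQ$. Assume that $L$ is almost regular: $\mathcal F$ has connected fibres and is a submersion onto a closed submanifold $\mathcal F(TQ)$ of $T^*Q$. Let $U\subset T^*Q$ be open, let $(\phi_\mu)$ be a finite set of independent primary hamiltonian constraints on $U$ (smooth functions on $U$ with $\mathcal F(TQ)\cap U=\{p\in U : \phi_\mu(p)=0 \text{ for all } \mu\}$ whose differentials $d\phi_\mu$ are linearly independent at the points of $\mathcal F(TQ)\cap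 U$), and let $H$ be a hamiltonian on $U$ (a smooth function on $U$ with $E = H\circ\mathcal F$ on $\mathcal F^{-1}(U)$). Write $\gamma_\mu=\gamma_{\phi_\mu}$. Then there exist smooth functions $\lambda^\mu$ on the open set $\mathcal F^{-1}(U)\subset TQ$ such that on $\mathcal F^{-1}(U)$ $$\mathrm{Id}_{TQ} = \gamma_H + \sum_\mu \gamma_\mu\,\lambda^\mu ,$$ and moreover, for every $v\in\mathcal F^{-1}(U)$ in the fibre $T_qQ$, $$\mathrm{Id}_{T_qQ} = M(v)\circ W(v) + \sum_\mu \gamma_\mu(v)\otimes D\lambda^\mu(v),$$ where $M = D^2H\circ\mathcal F + \sum_\mu (D^2\phi_\mu\circ\mathcal F)\,\lambda^\mu\colon \mathcal F^{-1}(U)\to\mathrm{Hom}(T^*Q,TQ)$. -/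

import Mathlib

open Bundle Set Filter Topology
open scoped Manifold ContDiff

noncomputable section

namespace FibreDer

section Calculus

variable {Q : Type*}

/-- The fibre derivative of a fibre preserving map `f : A → B` between (the total spaces of) vector
bundles over `Q`, given by its restrictions `f q : A q → B q` to the fibres: at the point `a` of
the fibre over `q` it is the ordinary derivative of `f q` at `a`, an element of
`Hom(A q, B q)`. -/
def fibreDeriv {A B : Q → Type*}
    [∀ q, AddCommGroup (A q)] [∀ q, Module ℝ (A q)] [∀ q, TopologicalSpace (A q)]
    [∀ q, AddCommGroup (B q)] [∀ q, Module ℝ (B q)] [∀ q, TopologicalSpace (B q)]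
    (f : ∀ q, A q → B q) : ∀ q, A q → (A q →L[ℝ] B q) :=
  fun q a => fderiv ℝ (f q) a

/-- A finite dimensional space is canonically isomorphic to its bidual, through evaluation. -/
def bidualEquiv (V : Type*) [NormedAddCommGroup V] [NormedSpace ℝ V] [FiniteDimensional ℝ V] :
    V ≃L[ℝ] ((V →L[ℝ] ℝ) →L[ℝ] ℝ) :=
  (LinearEquiv.ofInjectiveOfFinrankEq
    (NormedSpace.inclusionInDoubleDual ℝ V : V →ₗ[ℝ] ((V →L[ℝ] ℝ) →L[ℝ] ℝ))
    (NormedSpace.inclusionInDoubleDualLi (𝕜 := ℝ) (E := V)).injective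
    (by
      have h : ∀ (X : Type _) [NormedAddCommGroup X] [NormedSpace ℝ X] [FiniteDimensional ℝ X],
          Module.finrank ℝ (X →L[ℝ] ℝ) = Module.finrank ℝ X := fun X _ _ _ => by
        rw [← (LinearMap.toContinuousLinearMap (𝕜 := ℝ) (E := X) (F' := ℝ)).finrank_eq]
        exact Subspace.dual_finrank_eq
      rw [h, h])).toContinuousLinearEquiv

theorem bidualEquiv_apply (V : Type*) [NormedAddCommGroup V] [NormedSpace ℝ V]
    [FiniteDimensional ℝ V] (v : V) (α : V →L[ℝ] ℝ) : bidualEquiv V v α = α v := rfl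

end Calculus

section Submanifold

variable {E' : Type*} [NormedAddCommGroup E'] [NormedSpace ℝ E']
  {H' : Type*} [TopologicalSpace H'] (J : ModelWithCorners ℝ E' H')
  {N : Type*} [TopologicalSpace N] [ChartedSpace H' N]

/-- A subset `S` of a manifold is an (embedded, smooth) submanifold when around each of its points
there is a smooth chart of the ambient manifold in which `S` becomes an affine subspace. -/
def IsSubmanifold (S : Set N) : Prop :=
  ∀ p ∈ S, ∃ e ∈ IsManifold.maximalAtlas J ∞ N, p ∈ e.source ∧
    ∃ K : Submodule ℝ E', ∀ x ∈ e.source, x ∈ S ↔ e.extend J x - e.extend J p ∈ K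

/-- The vectors tangent to `S` at `p`: the velocities at time `0` of the smooth curves
that lie in `S` and pass through `p`. -/
def tangentTo (S : Set N) (p : N) : Set (TangentSpace J p) :=
  {w | ∃ c : ℝ → N, ContMDiffAt 𝓘(ℝ, ℝ) J ∞ c 0 ∧ (∀ᶠ t in 𝓝 (0 : ℝ), c t ∈ S) ∧
    (⟨c 0, mfderiv 𝓘(ℝ, ℝ) J c 0 (1 : ℝ)⟩ : TangentBundle J N) = ⟨p, w⟩}

end Submanifold

section Lagrangian

variable {E : Type*} [NormedAddCommGroup E] [NormedSpace ℝ E]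
  {Q : Type*} [TopologicalSpace Q] [ChartedSpace E Q]

/-- The cotangent space `T*_q Q`. -/
abbrev CotangentSpace (E : Type*) [NormedAddCommGroup E] [NormedSpace ℝ E]
    {Q : Type*} [TopologicalSpace Q] [ChartedSpace E Q] (q : Q) : Type _ :=
  TangentSpace 𝓘(ℝ, E) q →L[ℝ] ℝ

/-- The cotangent bundle `T*Q`, with the smooth structure that Mathlib puts on a bundle of
continuous linear maps. -/
abbrev CotangentBundle (E : Type*) [NormedAddCommGroup E] [NormedSpace ℝ E]
    (Q : Type*) [TopologicalSpace Q] [ChartedSpace E Q] : Type _ :=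
  TotalSpace (E →L[ℝ] ℝ) (fun q : Q => CotangentSpace E q)

/-- The model with corners of the tangent bundle. -/
abbrev modelT (E : Type*) [NormedAddCommGroup E] [NormedSpace ℝ E] :
    ModelWithCorners ℝ (E × E) (ModelProd E E) :=
  𝓘(ℝ, E).prod 𝓘(ℝ, E)

/-- The model with corners of the cotangent bundle. -/
abbrev modelCoT (E : Type*) [NormedAddCommGroup E] [NormedSpace ℝ E] :
    ModelWithCorners ℝ (E × (E →L[ℝ] ℝ)) (ModelProd E (E →L[ℝ] ℝ)) :=
  𝓘(ℝ, E).prod 𝓘(ℝ, E →L[ℝ] ℝ)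

/-- The fibre derivative `D g (v) ∈ T*_q Q` of a function `g` on `TQ` at `v ∈ T_q Q`. -/
def DT (g : TangentBundle 𝓘(ℝ, E) Q → ℝ) (v : TangentBundle 𝓘(ℝ, E) Q) :
    CotangentSpace E v.1 :=
  fibreDeriv (A := fun q : Q => TangentSpace 𝓘(ℝ, E) q) (B := fun _ => ℝ)
    (fun q w => g ⟨q, w⟩) v.1 v.2

/-- The Legendre map `ℱ = D L : TQ → T*Q`. -/
def legendre (L : TangentBundle 𝓘(ℝ, E) Q → ℝ) (v : TangentBundle 𝓘(ℝ, E) Q) :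
    CotangentBundle E Q :=
  ⟨v.1, DT L v⟩

/-- The fibre hessian `W = D ℱ : TQ → Hom(TQ, T*Q)`. -/
def hessian (L : TangentBundle 𝓘(ℝ, E) Q → ℝ) (v : TangentBundle 𝓘(ℝ, E) Q) :
    TangentSpace 𝓘(ℝ, E) v.1 →L[ℝ] CotangentSpace E v.1 :=
  fibreDeriv (A := fun q : Q => TangentSpace 𝓘(ℝ, E) q) (B := fun q : Q => CotangentSpace E q)
    (fun q w => (legendre L ⟨q, w⟩).2) v.1 v.2

/-- The energy `E(v) = ⟨D L(v), v⟩ - L(v)`. -/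
def energy (L : TangentBundle 𝓘(ℝ, E) Q → ℝ) (v : TangentBundle 𝓘(ℝ, E) Q) : ℝ :=
  DT L v v.2 - L v

variable [FiniteDimensional ℝ E]

/-- The canonical isomorphism `T_q Q ≅ T**_q Q`. -/
def toBidual (q : Q) :
    TangentSpace 𝓘(ℝ, E) q ≃L[ℝ] (CotangentSpace E q →L[ℝ] ℝ) :=
  bidualEquiv E

theorem toBidual_apply (q : Q) (v : TangentSpace 𝓘(ℝ, E) q) (α : CotangentSpace E q) :
    toBidual q v α = α v := rfl

/-- The fibre derivative `D h (p) ∈ T**_q Q ≅ T_q Q` of a function `h` on `T*Q`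
at `p ∈ T*_q Q`. -/
def DCoT (h : CotangentBundle E Q → ℝ) (p : CotangentBundle E Q) : TangentSpace 𝓘(ℝ, E) p.1 :=
  (toBidual p.1).symm
    (fibreDeriv (A := fun q : Q => CotangentSpace E q) (B := fun _ => ℝ)
      (fun q α => h ⟨q, α⟩) p.1 p.2)

/-- The second fibre derivative `D² h (p) ∈ Hom(T*_q Q, T_q Q)` of a function `h` on `T*Q`
at `p ∈ T*_q Q`. -/
def D2CoT (h : CotangentBundle E Q → ℝ) (p : CotangentBundle E Q) :
    CotangentSpace E p.1 →L[ℝ] TangentSpace 𝓘(ℝ, E) p.1 :=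
  fibreDeriv (A := fun q : Q => CotangentSpace E q) (B := fun q : Q => TangentSpace 𝓘(ℝ, E) q)
    (fun q α => DCoT h ⟨q, α⟩) p.1 p.2

/-- The map `γ_h = D h ∘ ℱ : TQ → TQ` over the identity of `Q`. -/
def gam (L : TangentBundle 𝓘(ℝ, E) Q → ℝ) (h : CotangentBundle E Q → ℝ)
    (v : TangentBundle 𝓘(ℝ, E) Q) : TangentSpace 𝓘(ℝ, E) v.1 :=
  DCoT h (legendre L v)

variable [IsManifold 𝓘(ℝ, E) ∞ Q]

/-- A smooth lagrangian is almost regular when its Legendre map has connected fibres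
and is a submersion onto a closed submanifold of `T*Q`. -/
structure AlmostRegular (L : TangentBundle 𝓘(ℝ, E) Q → ℝ) : Prop where
  smooth : ContMDiff (modelT E) 𝓘(ℝ, ℝ) ∞ L
  isClosed_range : IsClosed (range (legendre L))
  isSubmanifold_range : IsSubmanifold (modelCoT E) (range (legendre L))
  submersion : ∀ v, range (mfderiv (modelT E) (modelCoT E) (legendre L) v) =
    tangentTo (modelCoT E) (range (legendre L)) (legendre L v)
  connected_fibres : ∀ p ∈ range (legendre L), IsConnected (legendre L ⁻¹' {p})

/-- `φ_μ` is an independent set of primary hamiltonian constraints on the open set `U` of `T*Q`: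
these are smooth functions on `U`, their vanishing defines the primary constraint submanifold
`ℱ(TQ)` inside `U`, and their differentials are linearly independent at its points. -/
structure IsIndependentPrimaryConstraints {ι : Type*} (L : TangentBundle 𝓘(ℝ, E) Q → ℝ)
    (U : Set (CotangentBundle E Q)) (φ : ι → CotangentBundle E Q → ℝ) : Prop where
  smooth : ∀ μ, ContMDiffOn (modelCoT E) 𝓘(ℝ, ℝ) ∞ (φ μ) U
  mem_range_iff : ∀ p ∈ U, p ∈ range (legendre L) ↔ ∀ μ, φ μ p = 0
  independent : ∀ p ∈ U, p ∈ range (legendre L) →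
    LinearIndependent ℝ (fun μ => mvfderiv (modelCoT E) (φ μ) p)

/-- `H` is a hamiltonian for `L` on the open set `U` of `T*Q`: a smooth function with
`E = H ∘ ℱ` wherever the right hand side is defined. -/
structure IsHamiltonian (L : TangentBundle 𝓘(ℝ, E) Q → ℝ)
    (U : Set (CotangentBundle E Q)) (H : CotangentBundle E Q → ℝ) : Prop where
  smooth : ContMDiffOn (modelCoT E) 𝓘(ℝ, ℝ) ∞ H U
  energy_eq : ∀ v, legendre L v ∈ U → energy L v = H (legendre L v)

/-- `M = D²H ∘ ℱ + ∑_μ (D²φ_μ ∘ ℱ) λ^μ : TQ → Hom(T*Q, TQ)`. -/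
def opM {ι : Type*} [Fintype ι] (L : TangentBundle 𝓘(ℝ, E) Q → ℝ)
    (H : CotangentBundle E Q → ℝ) (φ : ι → CotangentBundle E Q → ℝ)
    (lam : ι → TangentBundle 𝓘(ℝ, E) Q → ℝ) (v : TangentBundle 𝓘(ℝ, E) Q) :
    CotangentSpace E v.1 →L[ℝ] TangentSpace 𝓘(ℝ, E) v.1 :=
  D2CoT H (legendre L v) + ∑ μ, lam μ v • D2CoT (φ μ) (legendre L v)

end Lagrangian

end FibreDer

end

open FibreDer

/-! Fix `v` over `q`. Differentiating `E = H ∘ ℱ` along the fibre shows that `v - γ_H(v)` is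
annihilated by the image of the hessian `W(v)` (`fderiv_fibreDT_apply_sub`). It then lies in the
span of the `γ_μ(v)`, by finite-dimensional duality, once every covector `α` annihilating all
`γ_μ(v)` is known to be in that image.

For such an `α` the vertical vector `(0, α)` is killed by every `dφ_μ`. Independence of the
constraints and the inverse function theorem make it the velocity of a curve in `ℱ(TQ)`
(`mem_tangentTo_range_legendre`). The submersion hypothesis lifts it to some `(x, b)`; since `ℱ`
covers the identity of `Q`, `x = 0` and `α = W(v) b`.

The `γ_μ(v)` are independent because the `dφ_μ` vanish on the image of `dℱ`, which projects onto all
base directions, so the `dφ_μ` stay independent on vertical vectors. Hence the multipliers are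
unique, and smooth by inverting a matrix (`contDiffAt_coeff_of_linearIndependent`). The second
identity is the fibre derivative of the first. -/

namespace FibreDer

/-! ### Linear algebra and calculus in normed spaces. -/

section Flat

variable {X V Y : Type*} [NormedAddCommGroup X] [NormedSpace ℝ X]
  [NormedAddCommGroup V] [NormedSpace ℝ V] [NormedAddCommGroup Y] [NormedSpace ℝ Y]
  {ι : Type*} [Fintype ι]

/-- Finitely many linearly independent functionals are jointly surjective. -/
theorem surjective_pi_of_linearIndependent {B : ι → X →L[ℝ] ℝ} (hB : LinearIndependent ℝ B) :
    Function.Surjective (ContinuousLinearMap.pi B) := by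
  classical
  by_contra hs
  have hlt : (ContinuousLinearMap.pi B : X →ₗ[ℝ] ι → ℝ).range < ⊤ :=
    lt_top_iff_ne_top.2 fun h => hs (LinearMap.range_eq_top.1 h)
  -- A nonzero functional killing a proper range has as coordinates the coefficients of a vanishing
  -- combination of the `B μ`.
  obtain ⟨f, hf0, hf⟩ := Submodule.exists_le_ker_of_lt_top _ hlt
  have hfc : ∀ y : ι → ℝ, f y = ∑ μ, f (Pi.single μ 1) * y μ := fun y => by
    conv_lhs => rw [LinearMap.pi_apply_eq_sum_univ f y]
    exact Finset.sum_congr rfl fun μ _ => by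
      rw [smul_eq_mul, mul_comm]; congr 2; ext j; simp [Pi.single_apply, eq_comm]
  have hzero : ∑ μ, f (Pi.single μ 1) • B μ = 0 := by
    ext x
    have h := hf (LinearMap.mem_range_self (ContinuousLinearMap.pi B : X →ₗ[ℝ] ι → ℝ) x)
    rw [LinearMap.mem_ker, hfc] at h
    simpa using h
  have hc := Fintype.linearIndependent_iff.1 hB _ hzero
  refine hf0 (LinearMap.ext fun y => ?_)
  rw [hfc]
  simp [hc]

/-- A vector annihilated by the surjective derivative of a smooth map is the velocity of a smooth
curve in the zero locus. -/
theorem exists_contDiffAt_curve_mem_zero_locus [CompleteSpace X] {Φ : X → ι → ℝ} {x₀ w : X}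
    {Φ' : X →L[ℝ] ι → ℝ} (hΦ : ContDiffAt ℝ ∞ Φ x₀) (hΦ' : HasFDerivAt Φ Φ' x₀)
    (h0 : Φ x₀ = 0) (hsurj : Function.Surjective Φ') (hw : Φ' w = 0) :
    ∃ c : ℝ → X, ContDiffAt ℝ ∞ c 0 ∧ c 0 = x₀ ∧ HasDerivAt c w 0 ∧
      ∀ᶠ t in 𝓝 (0 : ℝ), Φ (c t) = 0 := by
  obtain ⟨R, hR⟩ := (Φ' : X →ₗ[ℝ] ι → ℝ).exists_rightInverse_of_surjective
    (LinearMap.range_eq_top.2 hsurj)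
  let R' : (ι → ℝ) →L[ℝ] X := LinearMap.toContinuousLinearMap R
  have hR' : ∀ y, Φ' (R' y) = y := fun y => LinearMap.congr_fun hR y
  let aff : ℝ × (ι → ℝ) →L[ℝ] X :=
    (ContinuousLinearMap.fst ℝ ℝ (ι → ℝ)).smulRight w + R' ∘L ContinuousLinearMap.snd ℝ ℝ (ι → ℝ)
  have haff : ∀ z, aff z = z.1 • w + R' z.2 := fun z => rfl
  -- Restricting `Φ` to the directions `w` and `range R` makes `G` a map between equal
  -- finite-dimensional spaces. Its derivative at `0` is the identity because `Φ' w = 0` and `Φ' ∘ R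
  -- = id`. The required curve is the image of the line `(t, 0)` under the local inverse.
  let G : ℝ × (ι → ℝ) → ℝ × (ι → ℝ) := fun z => (z.1, Φ (x₀ + aff z))
  have hx : x₀ + aff 0 = x₀ := by simp
  have hG : ContDiffAt ℝ ∞ G 0 := by
    refine contDiffAt_fst.prodMk (ContDiffAt.comp (0 : ℝ × (ι → ℝ)) (g := Φ) ?_ ?_)
    · rwa [hx]
    · exact contDiffAt_const.add aff.contDiff.contDiffAt
  have hG' : HasFDerivAt G
      ((ContinuousLinearEquiv.refl ℝ (ℝ × (ι → ℝ)) : ℝ × (ι → ℝ) →L[ℝ] ℝ × (ι → ℝ))) 0 := by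
    have h1 : HasFDerivAt (fun z => Φ (x₀ + aff z)) (Φ' ∘L aff) 0 := by
      refine HasFDerivAt.comp (0 : ℝ × (ι → ℝ)) (g := Φ) ?_ (aff.hasFDerivAt.const_add x₀)
      rwa [hx]
    have h2 : HasFDerivAt (Prod.fst : ℝ × (ι → ℝ) → ℝ) (ContinuousLinearMap.fst ℝ ℝ (ι → ℝ)) 0 :=
      hasFDerivAt_fst
    refine (h2.prodMk h1).congr_fderiv (ContinuousLinearMap.ext fun z => Prod.ext rfl ?_)
    change Φ' (aff z) = z.2
    rw [haff, map_add, map_smul, hw, hR', smul_zero, zero_add]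
  have hne : (∞ : WithTop ℕ∞) ≠ 0 := by simp
  have hG0 : G 0 = 0 := by
    change ((0 : ℝ), Φ (x₀ + aff 0)) = 0
    rw [hx, h0]; rfl
  let g := hG.localInverse hG' hne
  have hg : ContDiffAt ℝ ∞ g 0 := hG0 ▸ hG.to_localInverse hG' hne
  have hg0 : g 0 = 0 := by
    have := hG.localInverse_apply_image hG' hne
    rwa [hG0] at this
  have hgr : ∀ᶠ z in 𝓝 (0 : ℝ × (ι → ℝ)), G (g z) = z := by
    have := (hG.hasStrictFDerivAt' hG' hne).eventually_right_inverse
    rwa [hG0] at this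
  have hg' : HasFDerivAt g (ContinuousLinearMap.id ℝ (ℝ × (ι → ℝ))) 0 := by
    have := (hG.hasStrictFDerivAt' hG' hne).to_localInverse.hasFDerivAt
    rwa [hG0] at this
  have hin : ContDiff ℝ ∞ (fun t : ℝ => (t, (0 : ι → ℝ))) := contDiff_id.prodMk contDiff_const
  have hin' : HasDerivAt (fun t : ℝ => (t, (0 : ι → ℝ))) (1, 0) 0 :=
    (hasDerivAt_id (0 : ℝ)).prodMk (hasDerivAt_const _ _)
  refine ⟨fun t => x₀ + aff (g (t, 0)), ?_, ?_, ?_, ?_⟩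
  · exact contDiffAt_const.add (aff.contDiff.contDiffAt.comp (0 : ℝ)
      (ContDiffAt.comp (0 : ℝ) (g := g) hg hin.contDiffAt))
  · change x₀ + aff (g 0) = x₀
    rw [hg0, hx]
  · have h1 : HasDerivAt (fun t : ℝ => g (t, 0)) (1, 0) 0 := by
      exact HasFDerivAt.comp_hasDerivAt (0 : ℝ) (l := g) (l' := ContinuousLinearMap.id ℝ _)
        hg' hin'
    have h2 := (aff.hasFDerivAt.comp_hasDerivAt (0 : ℝ) h1).const_add x₀
    simpa [haff] using h2
  · have htend : Tendsto (fun t : ℝ => (t, (0 : ι → ℝ))) (𝓝 0) (𝓝 0) :=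
      hin.continuous.tendsto' 0 0 rfl
    filter_upwards [htend.eventually hgr] with t ht
    exact congrArg Prod.snd ht

/-- The coefficients of a smooth map with respect to a smooth linearly independent family
are smooth. -/
theorem contDiffAt_coeff_of_linearIndependent [FiniteDimensional ℝ V] {x₀ : X} {g : ι → X → V}
    {s : X → V} {lam : X → ι → ℝ} (hg : ∀ μ, ContDiffAt ℝ ∞ (g μ) x₀) (hs : ContDiffAt ℝ ∞ s x₀)
    (hind : LinearIndependent ℝ fun μ => g μ x₀)
    (heq : ∀ᶠ x in 𝓝 x₀, s x = ∑ μ, lam x μ • g μ x) : ContDiffAt ℝ ∞ lam x₀ := by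
  classical
  let G : X → (ι → ℝ) →L[ℝ] V := fun x =>
    ∑ μ, (ContinuousLinearMap.proj (R := ℝ) (φ := fun _ : ι => ℝ) μ).smulRight (g μ x)
  have hGapp : ∀ x c, G x c = ∑ μ, c μ • g μ x := fun x c => by simp [G]
  have hG : ContDiffAt ℝ ∞ G x₀ := by
    refine ContDiffAt.sum fun μ _ => ?_
    exact (ContinuousLinearMap.smulRightL ℝ (ι → ℝ) V
      (ContinuousLinearMap.proj (R := ℝ) (φ := fun _ : ι => ℝ) μ)).contDiff.contDiffAt.comp x₀ (hg μ)
  obtain ⟨P, hP⟩ := (G x₀ : (ι → ℝ) →ₗ[ℝ] V).exists_leftInverse_of_injective (by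
    rw [LinearMap.ker_eq_bot']
    intro c hc
    have hc' : ∑ μ, c μ • g μ x₀ = 0 := by rw [← hGapp]; exact hc
    exact funext (Fintype.linearIndependent_iff.1 hind c hc'))
  let P' : V →L[ℝ] ι → ℝ := LinearMap.toContinuousLinearMap P
  -- `B` is the identity at `x₀`, hence invertible nearby, and there `lam = B⁻¹ (P' s)`. No
  -- regularity of `lam` is needed beforehand.
  let B : X → (ι → ℝ) →L[ℝ] ι → ℝ := fun x => P' ∘L G x
  have hB : ContDiffAt ℝ ∞ B x₀ := contDiffAt_const.clm_comp hG
  have hB0 : B x₀ = (ContinuousLinearEquiv.refl ℝ (ι → ℝ) : (ι → ℝ) →L[ℝ] ι → ℝ) :=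
    ContinuousLinearMap.ext fun c => LinearMap.congr_fun hP c
  have hinv : ContDiffAt ℝ ∞ (fun x => (B x).inverse (P' (s x))) x₀ := by
    refine ContDiffAt.clm_apply (ContDiffAt.comp x₀ (g := ContinuousLinearMap.inverse) ?_ hB)
      (P'.contDiff.contDiffAt.comp x₀ hs)
    rw [hB0]
    exact contDiffAt_map_inverse _
  refine hinv.congr_of_eventuallyEq ?_
  have hnear : ∀ᶠ x in 𝓝 x₀, B x ∈ range ((↑) : ((ι → ℝ) ≃L[ℝ] ι → ℝ) → (ι → ℝ) →L[ℝ] ι → ℝ) := by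
    refine hB.continuousAt.eventually ?_
    rw [hB0]
    exact ContinuousLinearEquiv.nhds _
  filter_upwards [heq, hnear] with x hx ⟨e, he⟩
  rw [hx, ← hGapp]
  change lam x = (B x).inverse (B x (lam x))
  rw [← he, ContinuousLinearMap.inverse_equiv]
  simp

/-- Functionals independent on `X × Y` that vanish on the graph of a map over `X` remain
independent when restricted to `Y`. -/
theorem linearIndependent_comp_inr {A : X × V →L[ℝ] Y} {B : ι → X × Y →L[ℝ] ℝ}
    (hB : LinearIndependent ℝ B) (hBA : ∀ μ z, B μ (z.1, A z) = 0) :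
    LinearIndependent ℝ fun μ => B μ ∘L ContinuousLinearMap.inr ℝ X Y := by
  rw [Fintype.linearIndependent_iff] at hB ⊢
  intro c hc
  refine hB c (ContinuousLinearMap.ext fun ⟨x, y⟩ => ?_)
  -- Subtracting the graph vector `(x, A (x, 0))`, on which every `B μ` vanishes, makes `(x, y)`
  -- vertical.
  have h1 := DFunLike.congr_fun hc (y - A (x, 0))
  have h2 : ∀ μ, B μ (x, y) = B μ (0, y - A (x, 0)) := fun μ => by
    have h3 := hBA μ (x, 0)
    have h4 : ((x, y) : X × Y) = (0, y - A (x, 0)) + (x, A (x, 0)) := by simp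
    rw [h4, map_add, h3, add_zero]
  simpa [h2] using h1

theorem contDiffAt_partial_fderiv {g : X × V → Y} {z : X × V} (hg : ContDiffAt ℝ ∞ g z) :
    ContDiffAt ℝ ∞ (fun z : X × V => fderiv ℝ (fun w => g (z.1, w)) z.2) z := by
  refine ContDiffAt.fderiv (n := ∞) (f := fun (z : X × V) w => g (z.1, w)) (g := Prod.snd)
    ?_ contDiffAt_snd le_rfl
  exact ContDiffAt.comp (g := g) (z, z.2) hg
    ((contDiffAt_fst.comp _ contDiffAt_fst).prodMk contDiffAt_snd)

theorem partial_fderiv_apply {g : X × V → Y} {z : X × V} (hg : DifferentiableAt ℝ g z) :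
    fderiv ℝ (fun w => g (z.1, w)) z.2 = fderiv ℝ g z ∘L ContinuousLinearMap.inr ℝ X V := by
  have h : HasFDerivAt (fun w => (z.1, w)) (ContinuousLinearMap.inr ℝ X V) z.2 :=
    hasFDerivAt_prodMk_right _ _
  exact (HasFDerivAt.comp z.2 (g := g) hg.hasFDerivAt h).fderiv

/-- Vectors whose evaluation functionals are linearly independent are linearly independent. -/
theorem linearIndependent_of_eval {g : ι → V} {T : ι → Y →L[ℝ] ℝ} {r : Y → V →L[ℝ] ℝ}
    (hT : ∀ μ y, T μ y = r y (g μ)) (hind : LinearIndependent ℝ T) : LinearIndependent ℝ g := by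
  rw [Fintype.linearIndependent_iff] at hind ⊢
  intro c hc
  refine hind c (ContinuousLinearMap.ext fun y => ?_)
  have h : r y (∑ μ, c μ • g μ) = 0 := by rw [hc, map_zero]
  simpa [hT] using h

/-- A vector annihilated by the common annihilator of a finite family lies in its span. -/
theorem exists_coeff_of_forall_eval_eq_zero {g : ι → V} {e : V}
    (h : ∀ y : V →L[ℝ] ℝ, (∀ μ, y (g μ) = 0) → y e = 0) : ∃ c : ι → ℝ, e = ∑ μ, c μ • g μ := by
  let ev : V → (V →L[ℝ] ℝ) →ₗ[ℝ] ℝ := fun v =>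
    (ContinuousLinearMap.apply ℝ ℝ v : (V →L[ℝ] ℝ) →L[ℝ] ℝ)
  have hker : ⨅ μ, LinearMap.ker (ev (g μ)) ≤ LinearMap.ker (ev e) := fun y hy =>
    h y fun μ => (Submodule.mem_iInf _).1 hy μ
  obtain ⟨c, hc⟩ := (Submodule.mem_span_range_iff_exists_fun ℝ).1
    (mem_span_of_iInf_ker_le_ker hker)
  refine ⟨c, (SeparatingDual.eq_iff_forall_dual_eq (R := ℝ)).2 fun y => ?_⟩
  have h1 := LinearMap.congr_fun hc y
  simpa [ev] using h1.symm

end Flat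

/-! ### Bundle charts and fibre derivatives in coordinates. -/

noncomputable section Coordinates

variable {E : Type*} [NormedAddCommGroup E] [NormedSpace ℝ E]
  {Q : Type*} [TopologicalSpace Q] [ChartedSpace E Q] [IsManifold 𝓘(ℝ, E) ∞ Q]

/-- The identification of `T_q Q` with the model space through the chart around `q₀`. -/
def coordEquiv (q₀ q : Q) (hq : q ∈ (chartAt E q₀).source) : TangentSpace 𝓘(ℝ, E) q ≃L[ℝ] E :=
  (trivializationAt E (TangentSpace 𝓘(ℝ, E)) q₀).continuousLinearEquivAt ℝ q hq

theorem coordEquiv_self (q : Q) (u : TangentSpace 𝓘(ℝ, E) q) :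
    coordEquiv q q (mem_chart_source E q) u = u := by
  change (trivializationAt E (TangentSpace 𝓘(ℝ, E)) q ⟨q, u⟩).2 = u
  exact (tangentBundleCore 𝓘(ℝ, E) Q).coordChange_self _ _ (mem_achart_source E q) u

theorem extChartAt_tangent_apply (v₀ v : TangentBundle 𝓘(ℝ, E) Q)
    (hv : v.1 ∈ (chartAt E v₀.1).source) :
    extChartAt (modelT E) v₀ v = (extChartAt 𝓘(ℝ, E) v₀.1 v.1, coordEquiv v₀.1 v.1 hv v.2) := by
  rw [FiberBundle.extChartAt]
  rfl

/-- The trivialization of a hom bundle conjugates by those of its two factors, and the trivial line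
bundle contributes the identity. -/
theorem extChartAt_cotangent_apply (p₀ p : CotangentBundle E Q)
    (hp : p.1 ∈ (chartAt E p₀.1).source) :
    extChartAt (modelCoT E) p₀ p = (extChartAt 𝓘(ℝ, E) p₀.1 p.1,
      (p.2 : TangentSpace 𝓘(ℝ, E) p.1 →L[ℝ] ℝ) ∘L
        ((coordEquiv p₀.1 p.1 hp).symm : E →L[ℝ] TangentSpace 𝓘(ℝ, E) p.1)) := by
  rw [FiberBundle.extChartAt]
  refine Prod.ext rfl ?_
  change (trivializationAt (E →L[ℝ] ℝ) (fun q : Q => CotangentSpace E q) p₀.1 p).2 = _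
  have h := hom_trivializationAt_apply (RingHom.id ℝ) (F₁ := E)
    (E₁ := fun q : Q => TangentSpace 𝓘(ℝ, E) q) (F₂ := ℝ) (E₂ := fun _ : Q => ℝ) p₀.1 p
  rw [h]
  refine ContinuousLinearMap.ext fun w => ?_
  change Trivialization.continuousLinearMapAt ℝ (trivializationAt ℝ (Trivial Q ℝ) p₀.1) p.1
    (p.2 (Trivialization.symmL ℝ (trivializationAt E (TangentSpace 𝓘(ℝ, E)) p₀.1) p.1 w)) = _
  refine (DFunLike.congr_fun (Trivial.continuousLinearMapAt_trivialization ℝ Q ℝ p.1) _).trans ?_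
  exact congrArg p.2 (congrFun (Trivialization.symm_continuousLinearEquivAt_eq (R := ℝ)
    (trivializationAt E (TangentSpace 𝓘(ℝ, E)) p₀.1) hp).symm w)

/-- The expression of a function on `TQ` in the coordinates around `v₀`. -/
def locT (v₀ : TangentBundle 𝓘(ℝ, E) Q) (g : TangentBundle 𝓘(ℝ, E) Q → ℝ) (z : E × E) : ℝ :=
  g ((extChartAt (modelT E) v₀).symm z)

/-- The expression of a function on `T*Q` in the coordinates around `p₀`. -/
def locC (p₀ : CotangentBundle E Q) (h : CotangentBundle E Q → ℝ) (z : E × (E →L[ℝ] ℝ)) : ℝ :=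
  h ((extChartAt (modelCoT E) p₀).symm z)

theorem mem_extChartAt_tangent_source {v₀ v : TangentBundle 𝓘(ℝ, E) Q}
    (hv : v.1 ∈ (chartAt E v₀.1).source) : v ∈ (extChartAt (modelT E) v₀).source := by
  rw [extChartAt_source, TangentBundle.mem_chart_source_iff]
  exact hv

theorem mem_extChartAt_cotangent_source {p₀ p : CotangentBundle E Q}
    (hp : p.1 ∈ (chartAt E p₀.1).source) : p ∈ (extChartAt (modelCoT E) p₀).source := by
  have hp' : p.1 ∈ (trivializationAt (E →L[ℝ] ℝ) (fun q : Q => CotangentSpace E q) p₀.1).baseSet :=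
    ⟨hp, mem_univ _⟩
  rw [FiberBundle.extChartAt]
  refine ⟨(Trivialization.mem_source _).2 hp', ?_, mem_univ _⟩
  rw [extChartAt_source]
  exact hp

theorem locT_coord (v₀ : TangentBundle 𝓘(ℝ, E) Q) (g : TangentBundle 𝓘(ℝ, E) Q → ℝ) {q : Q}
    (hq : q ∈ (chartAt E v₀.1).source) (u : TangentSpace 𝓘(ℝ, E) q) :
    locT v₀ g (extChartAt 𝓘(ℝ, E) v₀.1 q, coordEquiv v₀.1 q hq u) = g ⟨q, u⟩ := by
  rw [locT, ← extChartAt_tangent_apply v₀ ⟨q, u⟩ hq,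
    (extChartAt (modelT E) v₀).left_inv (mem_extChartAt_tangent_source hq)]

theorem locC_coord (p₀ : CotangentBundle E Q) (h : CotangentBundle E Q → ℝ) {q : Q}
    (hq : q ∈ (chartAt E p₀.1).source) (α : CotangentSpace E q) :
    locC p₀ h (extChartAt 𝓘(ℝ, E) p₀.1 q, α ∘L ((coordEquiv p₀.1 q hq).symm :
      E →L[ℝ] TangentSpace 𝓘(ℝ, E) q)) = h ⟨q, α⟩ := by
  rw [locC, ← extChartAt_cotangent_apply p₀ ⟨q, α⟩ hq,
    (extChartAt (modelCoT E) p₀).left_inv (mem_extChartAt_cotangent_source hq)]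

/-- Chain rule: bundle charts are linear on fibres, so a fibre derivative transforms as a covector.
-/
theorem DT_eq_coord (v₀ : TangentBundle 𝓘(ℝ, E) Q) (g : TangentBundle 𝓘(ℝ, E) Q → ℝ) {q : Q}
    (hq : q ∈ (chartAt E v₀.1).source) (u : TangentSpace 𝓘(ℝ, E) q) :
    DT g ⟨q, u⟩ = fderiv ℝ (fun w => locT v₀ g (extChartAt 𝓘(ℝ, E) v₀.1 q, w))
      (coordEquiv v₀.1 q hq u) ∘L (coordEquiv v₀.1 q hq : TangentSpace 𝓘(ℝ, E) q →L[ℝ] E) := by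
  let A : E ≃L[ℝ] E := coordEquiv v₀.1 q hq
  have h := A.comp_right_fderiv
    (f := fun w => locT v₀ g (extChartAt 𝓘(ℝ, E) v₀.1 q, w)) (x := u)
  refine Eq.trans ?_ h
  have hf : (fun w => locT v₀ g (extChartAt 𝓘(ℝ, E) v₀.1 q, w)) ∘ A = fun w : E => g ⟨q, w⟩ :=
    funext fun w => locT_coord v₀ g hq w
  rw [hf]
  rfl

variable [FiniteDimensional ℝ E]

/-- The dual chain rule: by naturality of the bidual identification, the fibre derivative on `T*Q`
transforms as a vector. -/
theorem DCoT_eq_coord (p₀ : CotangentBundle E Q) (h : CotangentBundle E Q → ℝ) {q : Q}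
    (hq : q ∈ (chartAt E p₀.1).source) (α : CotangentSpace E q) :
    DCoT h ⟨q, α⟩ = (coordEquiv p₀.1 q hq).symm ((bidualEquiv E).symm
      (fderiv ℝ (fun a => locC p₀ h (extChartAt 𝓘(ℝ, E) p₀.1 q, a))
        (α ∘L ((coordEquiv p₀.1 q hq).symm : E →L[ℝ] TangentSpace 𝓘(ℝ, E) q)))) := by
  let A : E ≃L[ℝ] E := coordEquiv p₀.1 q hq
  let A' : (E →L[ℝ] ℝ) ≃L[ℝ] (E →L[ℝ] ℝ) := A.arrowCongr (ContinuousLinearEquiv.refl ℝ ℝ)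
  have hA' : ∀ α : E →L[ℝ] ℝ, A' α = α ∘L (A.symm : E →L[ℝ] E) := fun α =>
    ContinuousLinearMap.ext fun _ => rfl
  let f : (E →L[ℝ] ℝ) → ℝ := fun a => locC p₀ h (extChartAt 𝓘(ℝ, E) p₀.1 q, a)
  have hf : f ∘ A' = fun a : E →L[ℝ] ℝ => h ⟨q, a⟩ :=
    funext fun a => (congrArg f (hA' a)).trans (locC_coord p₀ h hq a)
  have hd := A'.comp_right_fderiv (f := f) (x := α)
  rw [hf] at hd
  apply (bidualEquiv E).injective
  refine Eq.trans ((bidualEquiv E).apply_symm_apply (fderiv ℝ (fun a : E →L[ℝ] ℝ => h ⟨q, a⟩) α)) ?_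
  rw [hd]
  refine ContinuousLinearMap.ext fun β => ?_
  have hb : ∀ (T : (E →L[ℝ] ℝ) →L[ℝ] ℝ) (β : E →L[ℝ] ℝ), T β = β ((bidualEquiv E).symm T) :=
    fun T β => by
      conv_lhs => rw [← (bidualEquiv E).apply_symm_apply T]
      rfl
  refine (hb _ (A' β)).trans ?_
  rw [hA']
  exact congrArg (fun a => (β ∘L (A.symm : E →L[ℝ] E)) ((bidualEquiv E).symm (fderiv ℝ f a))) (hA' α)

end Coordinates

/-! ### Smoothness and derivatives of the Legendre map and of functions on the bundles. -/

noncomputable section Smoothness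

variable {E : Type*} [NormedAddCommGroup E] [NormedSpace ℝ E]
  {Q : Type*} [TopologicalSpace Q] [ChartedSpace E Q] [IsManifold 𝓘(ℝ, E) ∞ Q]

theorem contDiff_bidualEquiv_symm [FiniteDimensional ℝ E] :
    ContDiff ℝ ∞ (bidualEquiv E).symm :=
  @ContinuousLinearEquiv.contDiff ℝ ((E →L[ℝ] ℝ) →L[ℝ] ℝ) E _
    ContinuousLinearMap.toNormedAddCommGroup ContinuousLinearMap.toNormedSpace _ _ _
    (bidualEquiv E).symm

/-- A chart reads the fibre over its own centre by the identity, so derivatives along that fibre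
need no change of coordinates. -/
theorem extChartAt_tangent_fibre (v₀ : TangentBundle 𝓘(ℝ, E) Q) (u : TangentSpace 𝓘(ℝ, E) v₀.1) :
    extChartAt (modelT E) v₀ ⟨v₀.1, u⟩ = (extChartAt 𝓘(ℝ, E) v₀.1 v₀.1, u) := by
  rw [extChartAt_tangent_apply v₀ ⟨v₀.1, u⟩ (mem_chart_source E v₀.1)]
  exact Prod.ext rfl (coordEquiv_self v₀.1 u)

theorem extChartAt_cotangent_fibre (p₀ : CotangentBundle E Q) (α : CotangentSpace E p₀.1) :
    extChartAt (modelCoT E) p₀ ⟨p₀.1, α⟩ = (extChartAt 𝓘(ℝ, E) p₀.1 p₀.1, α) := by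
  rw [extChartAt_cotangent_apply p₀ ⟨p₀.1, α⟩ (mem_chart_source E p₀.1)]
  refine Prod.ext rfl (ContinuousLinearMap.ext fun w => ?_)
  refine congrArg α ?_
  refine ((coordEquiv p₀.1 p₀.1 (mem_chart_source E p₀.1)).symm_apply_eq).2 ?_
  exact (coordEquiv_self p₀.1 w).symm

theorem locT_fibre (v₀ : TangentBundle 𝓘(ℝ, E) Q) (g : TangentBundle 𝓘(ℝ, E) Q → ℝ) (u : E) :
    locT v₀ g (extChartAt 𝓘(ℝ, E) v₀.1 v₀.1, u) = g ⟨v₀.1, u⟩ := by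
  have h := (extChartAt (modelT E) v₀).left_inv
    (mem_extChartAt_tangent_source (v := ⟨v₀.1, u⟩) (mem_chart_source E v₀.1))
  exact congrArg g
    ((congrArg (extChartAt (modelT E) v₀).symm (extChartAt_tangent_fibre v₀ u)).symm.trans h)

theorem locC_fibre (p₀ : CotangentBundle E Q) (h : CotangentBundle E Q → ℝ) (α : E →L[ℝ] ℝ) :
    locC p₀ h (extChartAt 𝓘(ℝ, E) p₀.1 p₀.1, α) = h ⟨p₀.1, α⟩ := by
  have h' := (extChartAt (modelCoT E) p₀).left_inv
    (mem_extChartAt_cotangent_source (p := ⟨p₀.1, α⟩) (mem_chart_source E p₀.1))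
  exact congrArg h
    ((congrArg (extChartAt (modelCoT E) p₀).symm (extChartAt_cotangent_fibre p₀ α)).symm.trans h')

theorem contDiffAt_locT {v₀ v : TangentBundle 𝓘(ℝ, E) Q} {g : TangentBundle 𝓘(ℝ, E) Q → ℝ}
    (hv : v.1 ∈ (chartAt E v₀.1).source) (hg : ContMDiffAt (modelT E) 𝓘(ℝ, ℝ) ∞ g v) :
    ContDiffAt ℝ ∞ (locT v₀ g) (extChartAt (modelT E) v₀ v) := by
  have hs := mem_extChartAt_tangent_source hv
  have h1 : ContMDiffAt 𝓘(ℝ, E × E) (modelT E) ∞ (extChartAt (modelT E) v₀).symm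
      (extChartAt (modelT E) v₀ v) :=
    (contMDiffOn_extChartAt_symm v₀).contMDiffAt (extChartAt_target_mem_nhds' (by
      exact (extChartAt (modelT E) v₀).map_source hs))
  refine (ContMDiffAt.comp (extChartAt (modelT E) v₀ v) (g := g) ?_ h1).contDiffAt
  rwa [(extChartAt (modelT E) v₀).left_inv hs]

theorem contDiffAt_locC {p₀ p : CotangentBundle E Q} {h : CotangentBundle E Q → ℝ}
    (hp : p.1 ∈ (chartAt E p₀.1).source) (hh : ContMDiffAt (modelCoT E) 𝓘(ℝ, ℝ) ∞ h p) :
    ContDiffAt ℝ ∞ (locC p₀ h) (extChartAt (modelCoT E) p₀ p) := by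
  have hs := mem_extChartAt_cotangent_source hp
  have h1 : ContMDiffAt 𝓘(ℝ, E × (E →L[ℝ] ℝ)) (modelCoT E) ∞ (extChartAt (modelCoT E) p₀).symm
      (extChartAt (modelCoT E) p₀ p) :=
    (contMDiffOn_extChartAt_symm p₀).contMDiffAt (extChartAt_target_mem_nhds' (by
      exact (extChartAt (modelCoT E) p₀).map_source hs))
  refine (ContMDiffAt.comp (extChartAt (modelCoT E) p₀ p) (g := h) ?_ h1).contDiffAt
  rwa [(extChartAt (modelCoT E) p₀).left_inv hs]

theorem contDiffAt_fibreT {q : Q} {u : E} {g : TangentBundle 𝓘(ℝ, E) Q → ℝ}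
    (hg : ContMDiffAt (modelT E) 𝓘(ℝ, ℝ) ∞ g ⟨q, u⟩) :
    ContDiffAt ℝ ∞ (fun w : E => g ⟨q, w⟩) u := by
  have h := contDiffAt_locT (v₀ := ⟨q, u⟩) (mem_chart_source E q) hg
  have h1 : extChartAt (modelT E) (⟨q, u⟩ : TangentBundle 𝓘(ℝ, E) Q) ⟨q, u⟩ =
    (extChartAt 𝓘(ℝ, E) q q, u) := extChartAt_tangent_fibre ⟨q, u⟩ u
  rw [h1] at h
  refine (ContDiffAt.comp u h (contDiffAt_const.prodMk contDiffAt_id)).congr_of_eventuallyEq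
    (Eventually.of_forall fun w => ?_)
  exact (locT_fibre ⟨q, u⟩ g w).symm

theorem contDiffAt_fibreC {q : Q} {a : E →L[ℝ] ℝ} {h : CotangentBundle E Q → ℝ}
    (hh : ContMDiffAt (modelCoT E) 𝓘(ℝ, ℝ) ∞ h ⟨q, a⟩) :
    ContDiffAt ℝ ∞ (fun b : E →L[ℝ] ℝ => h ⟨q, b⟩) a := by
  have h2 := contDiffAt_locC (p₀ := ⟨q, a⟩) (mem_chart_source E q) hh
  have h1 : extChartAt (modelCoT E) (⟨q, a⟩ : CotangentBundle E Q) ⟨q, a⟩ =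
    (extChartAt 𝓘(ℝ, E) q q, a) := extChartAt_cotangent_fibre ⟨q, a⟩ a
  rw [h1] at h2
  refine (ContDiffAt.comp a h2 (contDiffAt_const.prodMk contDiffAt_id)).congr_of_eventuallyEq
    (Eventually.of_forall fun b => ?_)
  exact (locC_fibre ⟨q, a⟩ h b).symm

/-- The fibre derivative of a function on `TQ` along the fibre over `q`, as a map of the model
spaces. -/
def fibreDT (g : TangentBundle 𝓘(ℝ, E) Q → ℝ) (q : Q) (u : E) : E →L[ℝ] ℝ :=
  fderiv ℝ (fun w : E => g ⟨q, w⟩) u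

/-- The fibre derivative of a function on `T*Q` along the fibre over `q`, as a map of the model
spaces. -/
def fibreDCoT [FiniteDimensional ℝ E] (h : CotangentBundle E Q → ℝ) (q : Q) (a : E →L[ℝ] ℝ) : E :=
  (bidualEquiv E).symm (fderiv ℝ (fun b : E →L[ℝ] ℝ => h ⟨q, b⟩) a)

theorem apply_fibreDCoT {E : Type*} [NormedAddCommGroup E] [NormedSpace ℝ E]
    [FiniteDimensional ℝ E] {Q : Type*} [TopologicalSpace Q] [ChartedSpace E Q]
    (h : CotangentBundle E Q → ℝ) (q : Q) (a b : E →L[ℝ] ℝ) :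
    b (fibreDCoT h q a) = fderiv ℝ (fun b : E →L[ℝ] ℝ => h ⟨q, b⟩) a b :=
  DFunLike.congr_fun ((bidualEquiv E).apply_symm_apply
    (fderiv ℝ (fun b : E →L[ℝ] ℝ => h ⟨q, b⟩) a)) b

theorem contDiffAt_fibreDT {q : Q} {u : E} {g : TangentBundle 𝓘(ℝ, E) Q → ℝ}
    (hg : ContMDiffAt (modelT E) 𝓘(ℝ, ℝ) ∞ g ⟨q, u⟩) : ContDiffAt ℝ ∞ (fibreDT g q) u :=
  (contDiffAt_fibreT hg).fderiv_right (m := ∞) le_rfl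

theorem contDiffAt_fibreDCoT [FiniteDimensional ℝ E] {q : Q} {a : E →L[ℝ] ℝ}
    {h : CotangentBundle E Q → ℝ} (hh : ContMDiffAt (modelCoT E) 𝓘(ℝ, ℝ) ∞ h ⟨q, a⟩) :
    ContDiffAt ℝ ∞ (fibreDCoT h q) a :=
  ContDiffAt.comp a contDiff_bidualEquiv_symm.contDiffAt
    ((contDiffAt_fibreC hh).fderiv_right (m := ∞) le_rfl)

/-- The Legendre map in the coordinates around `v₀`. -/
def locF (v₀ : TangentBundle 𝓘(ℝ, E) Q) (L : TangentBundle 𝓘(ℝ, E) Q → ℝ) (z : E × E) :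
    E × (E →L[ℝ] ℝ) :=
  (z.1, fderiv ℝ (fun w => locT v₀ L (z.1, w)) z.2)

/-- The coordinate change from `DT_eq_coord` cancels against the one in the cotangent chart. -/
theorem extChartAt_legendre (v₀ : TangentBundle 𝓘(ℝ, E) Q) (L : TangentBundle 𝓘(ℝ, E) Q → ℝ)
    {v : TangentBundle 𝓘(ℝ, E) Q} (hv : v.1 ∈ (chartAt E v₀.1).source) :
    extChartAt (modelCoT E) (legendre L v₀) (legendre L v) =
      locF v₀ L (extChartAt (modelT E) v₀ v) := by
  rw [extChartAt_cotangent_apply (legendre L v₀) (legendre L v) hv,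
    extChartAt_tangent_apply v₀ v hv]
  refine Prod.ext rfl (ContinuousLinearMap.ext fun w => ?_)
  refine (DFunLike.congr_fun (DT_eq_coord v₀ L hv v.2) _).trans ?_
  exact congrArg _ ((coordEquiv v₀.1 v.1 hv).apply_symm_apply w)

theorem contDiffAt_locF {v₀ : TangentBundle 𝓘(ℝ, E) Q} {L : TangentBundle 𝓘(ℝ, E) Q → ℝ}
    (hL : ContMDiffAt (modelT E) 𝓘(ℝ, ℝ) ∞ L v₀) :
    ContDiffAt ℝ ∞ (locF v₀ L) (extChartAt (modelT E) v₀ v₀) :=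
  contDiffAt_fst.prodMk
    (contDiffAt_partial_fderiv (contDiffAt_locT (mem_chart_source E v₀.1) hL))

theorem eventually_mem_chart_source (v₀ : TangentBundle 𝓘(ℝ, E) Q) :
    ∀ᶠ v in 𝓝 v₀, v.1 ∈ (chartAt E v₀.1).source := by
  filter_upwards [extChartAt_source_mem_nhds (I := modelT E) v₀] with v hv
  rwa [extChartAt_source, TangentBundle.mem_chart_source_iff] at hv

theorem eventually_symm_mem_chart_source (v₀ : TangentBundle 𝓘(ℝ, E) Q) :
    ∀ᶠ z in 𝓝 (extChartAt (modelT E) v₀ v₀), z ∈ (extChartAt (modelT E) v₀).target ∧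
      ((extChartAt (modelT E) v₀).symm z).1 ∈ (chartAt E v₀.1).source := by
  filter_upwards [extChartAt_target_mem_nhds (I := modelT E) v₀] with z hz
  have h := (extChartAt (modelT E) v₀).map_target hz
  rw [extChartAt_source, TangentBundle.mem_chart_source_iff] at h
  exact ⟨hz, h⟩

theorem contMDiff_legendre {L : TangentBundle 𝓘(ℝ, E) Q → ℝ}
    (hL : ContMDiff (modelT E) 𝓘(ℝ, ℝ) ∞ L) :
    ContMDiff (modelT E) (modelCoT E) ∞ (legendre L) := by
  intro v₀
  have h1 : ContMDiffAt 𝓘(ℝ, E × (E →L[ℝ] ℝ)) (modelCoT E) ∞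
      (extChartAt (modelCoT E) (legendre L v₀)).symm
      (locF v₀ L (extChartAt (modelT E) v₀ v₀)) := by
    rw [← extChartAt_legendre v₀ L (mem_chart_source E v₀.1)]
    exact (contMDiffOn_extChartAt_symm _).contMDiffAt (extChartAt_target_mem_nhds _)
  have h2 : ContMDiffAt (modelT E) 𝓘(ℝ, E × E) ∞ (extChartAt (modelT E) v₀) v₀ :=
    contMDiffAt_extChartAt
  have h3 := (h1.comp _ (contDiffAt_locF (hL v₀)).contMDiffAt).comp v₀ h2
  refine h3.congr_of_eventuallyEq ?_
  filter_upwards [eventually_mem_chart_source v₀] with v hv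
  simp only [Function.comp_apply]
  rw [← extChartAt_legendre v₀ L hv, (extChartAt (modelCoT E) (legendre L v₀)).left_inv
    (mem_extChartAt_cotangent_source (p₀ := legendre L v₀) (p := legendre L v) hv)]

theorem eventually_fibre_mem {L : TangentBundle 𝓘(ℝ, E) Q → ℝ}
    {U : Set (CotangentBundle E Q)} (hL : ContMDiff (modelT E) 𝓘(ℝ, ℝ) ∞ L) (hU : IsOpen U) {q : Q}
    {u : E} (hv : legendre L ⟨q, u⟩ ∈ U) : ∀ᶠ w : E in 𝓝 u, legendre L ⟨q, w⟩ ∈ U := by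
  have hc : Continuous fun w : E => (⟨q, w⟩ : TangentBundle 𝓘(ℝ, E) Q) :=
    FiberBundle.continuous_totalSpaceMk E (TangentSpace 𝓘(ℝ, E)) q
  exact ((hU.preimage ((contMDiff_legendre hL).continuous.comp hc)).mem_nhds hv)

/-- Turns the submersion hypothesis into a statement about an ordinary derivative. -/
theorem mfderiv_legendre {L : TangentBundle 𝓘(ℝ, E) Q → ℝ}
    (hL : ContMDiff (modelT E) 𝓘(ℝ, ℝ) ∞ L) (v₀ : TangentBundle 𝓘(ℝ, E) Q) :
    mfderiv (modelT E) (modelCoT E) (legendre L) v₀ =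
      fderiv ℝ (locF v₀ L) (extChartAt (modelT E) v₀ v₀) := by
  have hd : MDifferentiableAt (modelT E) (modelCoT E) (legendre L) v₀ :=
    (contMDiff_legendre hL v₀).mdifferentiableAt (by simp)
  rw [hd.mfderiv, ModelWithCorners.range_eq_univ, fderivWithin_univ]
  refine Filter.EventuallyEq.fderiv_eq ?_
  filter_upwards [eventually_symm_mem_chart_source v₀] with z hz
  simp only [writtenInExtChartAt, Function.comp_apply]
  rw [extChartAt_legendre v₀ L hz.2, (extChartAt (modelT E) v₀).right_inv hz.1]

theorem mvfderiv_eq_fderiv_locC {h : CotangentBundle E Q → ℝ} {p : CotangentBundle E Q}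
    (hh : ContMDiffAt (modelCoT E) 𝓘(ℝ, ℝ) ∞ h p) :
    mvfderiv (modelCoT E) h p = fderiv ℝ (locC p h) (extChartAt (modelCoT E) p p) := by
  have hd : MDifferentiableAt (modelCoT E) 𝓘(ℝ, ℝ) h p := hh.mdifferentiableAt (by simp)
  rw [mvfderiv, hd.mfderiv, ModelWithCorners.range_eq_univ, fderivWithin_univ]
  rfl

/-- Converts a velocity computed in the chart at `p` into the form asked for by `tangentTo`. -/
theorem tangentBundle_mk_mfderiv_curve {E' : Type*} [NormedAddCommGroup E'] [NormedSpace ℝ E']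
    {H' : Type*} [TopologicalSpace H'] (J : ModelWithCorners ℝ E' H')
    {N : Type*} [TopologicalSpace N] [ChartedSpace H' N] {c : ℝ → N} {p : N} {w : E'}
    (hp : c 0 = p) (hc : ContinuousAt c 0) (hd : HasDerivAt (fun t => extChartAt J p (c t)) w 0) :
    (⟨c 0, mfderiv 𝓘(ℝ, ℝ) J c 0 (1 : ℝ)⟩ : TangentBundle J N) = ⟨p, w⟩ := by
  subst hp
  have h : HasMFDerivAt 𝓘(ℝ, ℝ) J c 0 (ContinuousLinearMap.toSpanSingleton ℝ w) := by
    refine ⟨hc, ?_⟩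
    exact hd.hasFDerivAt.hasFDerivWithinAt
  rw [h.mfderiv]
  refine congrArg _ ?_
  exact one_smul ℝ w

end Smoothness

/-! ### The maps `γ_h`, and tangent vectors to the constraint submanifold. -/

noncomputable section Multipliers

variable {E : Type*} [NormedAddCommGroup E] [NormedSpace ℝ E] [FiniteDimensional ℝ E]
  {Q : Type*} [TopologicalSpace Q] [ChartedSpace E Q] [IsManifold 𝓘(ℝ, E) ∞ Q]
  {L : TangentBundle 𝓘(ℝ, E) Q → ℝ} {U : Set (CotangentBundle E Q)}

/-- The map `γ_h` in the coordinates around `v₀`. -/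
def locGam (v₀ : TangentBundle 𝓘(ℝ, E) Q) (L : TangentBundle 𝓘(ℝ, E) Q → ℝ)
    (h : CotangentBundle E Q → ℝ) (z : E × E) : E :=
  (bidualEquiv E).symm (fderiv ℝ (fun a => locC (legendre L v₀) h (z.1, a)) (locF v₀ L z).2)

/-- Transports the multiplier equation from the varying fibres to the fixed space `E`. -/
theorem coordEquiv_gam (v₀ : TangentBundle 𝓘(ℝ, E) Q) (L : TangentBundle 𝓘(ℝ, E) Q → ℝ)
    (h : CotangentBundle E Q → ℝ) {v : TangentBundle 𝓘(ℝ, E) Q}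
    (hv : v.1 ∈ (chartAt E v₀.1).source) :
    coordEquiv v₀.1 v.1 hv (gam L h v) = locGam v₀ L h (extChartAt (modelT E) v₀ v) := by
  have h1 := extChartAt_legendre v₀ L hv
  have h2 := extChartAt_cotangent_apply (legendre L v₀) (legendre L v) hv
  have h3 := congrArg Prod.fst (extChartAt_tangent_apply v₀ v hv)
  have h4 := congrArg Prod.snd (h2.symm.trans h1)
  refine (congrArg _ (DCoT_eq_coord (legendre L v₀) h (q := v.1) hv (DT L v))).trans ?_
  refine ((coordEquiv v₀.1 v.1 hv).apply_symm_apply _).trans ?_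
  rw [locGam, ← h4, h3]
  rfl

theorem locGam_self (v : TangentBundle 𝓘(ℝ, E) Q) (L : TangentBundle 𝓘(ℝ, E) Q → ℝ)
    (h : CotangentBundle E Q → ℝ) : locGam v L h (extChartAt (modelT E) v v) = gam L h v :=
  (coordEquiv_gam v L h (mem_chart_source E v.1)).symm.trans (coordEquiv_self v.1 _)

theorem contDiffAt_locGam {v₀ : TangentBundle 𝓘(ℝ, E) Q} {h : CotangentBundle E Q → ℝ}
    (hL : ContMDiffAt (modelT E) 𝓘(ℝ, ℝ) ∞ L v₀)
    (hh : ContMDiffAt (modelCoT E) 𝓘(ℝ, ℝ) ∞ h (legendre L v₀)) :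
    ContDiffAt ℝ ∞ (locGam v₀ L h) (extChartAt (modelT E) v₀ v₀) := by
  have h1 := contDiffAt_locC (p₀ := legendre L v₀) (p := legendre L v₀)
    (mem_chart_source E v₀.1) hh
  rw [extChartAt_legendre v₀ L (mem_chart_source E v₀.1)] at h1
  exact ContDiffAt.comp (extChartAt (modelT E) v₀ v₀) contDiff_bidualEquiv_symm.contDiffAt
    (ContDiffAt.comp (extChartAt (modelT E) v₀ v₀) (contDiffAt_partial_fderiv h1)
      (contDiffAt_locF hL))

/-- Differentiating `E = H ∘ ℱ` along the fibre: the image of the hessian annihilates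
`v - γ_H(v)`. -/
theorem fderiv_fibreDT_apply_sub {H : CotangentBundle E Q → ℝ}
    (hL : ContMDiff (modelT E) 𝓘(ℝ, ℝ) ∞ L) (hU : IsOpen U) (hH : IsHamiltonian L U H) {q : Q} {u : E}
    (hv : legendre L ⟨q, u⟩ ∈ U) (b : E) :
    fderiv ℝ (fibreDT L q) u b (u - fibreDCoT H q (fibreDT L q u)) = 0 := by
  have hl : HasFDerivAt (fibreDT L q) (fderiv ℝ (fibreDT L q) u) u :=
    ((contDiffAt_fibreDT (hL ⟨q, u⟩)).differentiableAt (by simp)).hasFDerivAt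
  have hLq : HasFDerivAt (fun w : E => L ⟨q, w⟩) (fibreDT L q u) u :=
    ((contDiffAt_fibreT (hL ⟨q, u⟩)).differentiableAt (by simp)).hasFDerivAt
  have hHq : HasFDerivAt (fun a : E →L[ℝ] ℝ => H ⟨q, a⟩)
      (fderiv ℝ (fun a : E →L[ℝ] ℝ => H ⟨q, a⟩) (fibreDT L q u)) (fibreDT L q u) :=
    ((contDiffAt_fibreC (hH.smooth.contMDiffAt (hU.mem_nhds hv))).differentiableAt
      (by simp)).hasFDerivAt
  -- In the derivative of the energy the term `DL(u) b` cancels, leaving `⟨W b, u⟩`.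
  have h1 := (hl.clm_apply (hasFDerivAt_id u)).sub hLq
  have h2 := hHq.comp u hl
  have heq : (fun w : E => fibreDT L q w w - L ⟨q, w⟩) =ᶠ[𝓝 u]
      (fun a : E →L[ℝ] ℝ => H ⟨q, a⟩) ∘ fibreDT L q := by
    filter_upwards [eventually_fibre_mem hL hU hv] with w hw
    exact hH.energy_eq ⟨q, w⟩ hw
  have h3 := DFunLike.congr_fun (h1.unique (h2.congr_of_eventuallyEq heq)) b
  rw [map_sub, apply_fibreDCoT]
  simpa [sub_eq_zero] using h3

variable {ι : Type*} [Fintype ι] {φ : ι → CotangentBundle E Q → ℝ}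

/-- Every vector annihilated by the differentials of the constraints is tangent to the image
of the Legendre map. -/
theorem mem_tangentTo_range_legendre (hU : IsOpen U) (hφ : IsIndependentPrimaryConstraints L U φ)
    {p : CotangentBundle E Q} (hp : p ∈ U) (hpr : p ∈ range (legendre L)) {z : E × (E →L[ℝ] ℝ)}
    (hz : ∀ μ, fderiv ℝ (locC p (φ μ)) (extChartAt (modelCoT E) p p) z = 0) :
    z ∈ tangentTo (modelCoT E) (range (legendre L)) p := by
  have hsm : ∀ μ, ContMDiffAt (modelCoT E) 𝓘(ℝ, ℝ) ∞ (φ μ) p := fun μ =>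
    (hφ.smooth μ).contMDiffAt (hU.mem_nhds hp)
  have hloc : ∀ μ, ContDiffAt ℝ ∞ (locC p (φ μ)) (extChartAt (modelCoT E) p p) := fun μ =>
    contDiffAt_locC (mem_chart_source E p.1) (hsm μ)
  have hind : LinearIndependent ℝ
      fun μ => fderiv ℝ (locC p (φ μ)) (extChartAt (modelCoT E) p p) := by
    have h := hφ.independent p hp hpr
    rwa [show (fun μ => mvfderiv (modelCoT E) (φ μ) p) =
      fun μ => fderiv ℝ (locC p (φ μ)) (extChartAt (modelCoT E) p p) from
        funext fun μ => mvfderiv_eq_fderiv_locC (hsm μ)] at h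
  have hleft := (extChartAt (modelCoT E) p).left_inv (mem_extChartAt_source (I := modelCoT E) p)
  obtain ⟨c, hc, hc0, hcd, hcz⟩ := exists_contDiffAt_curve_mem_zero_locus
    (Φ := fun y μ => locC p (φ μ) y) (w := z) (contDiffAt_pi.2 hloc)
    (hasFDerivAt_pi.2 fun μ => ((hloc μ).differentiableAt (by simp)).hasFDerivAt)
    (funext fun μ => by
      change φ μ ((extChartAt (modelCoT E) p).symm _) = 0
      rw [hleft]
      exact (hφ.mem_range_iff p hp).1 hpr μ)
    (surjective_pi_of_linearIndependent hind) (funext hz)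
  have hsymm : ContMDiffAt 𝓘(ℝ, E × (E →L[ℝ] ℝ)) (modelCoT E) ∞ (extChartAt (modelCoT E) p).symm
      (c 0) := by
    rw [hc0]
    exact (contMDiffOn_extChartAt_symm p).contMDiffAt (extChartAt_target_mem_nhds p)
  have hcs : ContMDiffAt 𝓘(ℝ, ℝ) (modelCoT E) ∞
      (fun t => (extChartAt (modelCoT E) p).symm (c t)) 0 :=
    hsymm.comp (0 : ℝ) hc.contMDiffAt
  have h0 : (extChartAt (modelCoT E) p).symm (c 0) = p := by rw [hc0, hleft]
  refine ⟨fun t => (extChartAt (modelCoT E) p).symm (c t), hcs, ?_, ?_⟩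
  -- The constraints characterize the range only inside `U`, so the curve must be kept there.
  · have hUev : ∀ᶠ t in 𝓝 (0 : ℝ), (extChartAt (modelCoT E) p).symm (c t) ∈ U :=
      hcs.continuousAt.eventually_mem (hU.mem_nhds (by rwa [h0]))
    filter_upwards [hcz, hUev] with t ht htU
    exact (hφ.mem_range_iff _ htU).2 fun μ => congrFun ht μ
  · refine tangentBundle_mk_mfderiv_curve (modelCoT E) h0 hcs.continuousAt ?_
    refine hcd.congr_of_eventuallyEq ?_
    have ht : ∀ᶠ t in 𝓝 (0 : ℝ), c t ∈ (extChartAt (modelCoT E) p).target :=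
      hc.continuousAt.eventually_mem (by rw [hc0]; exact extChartAt_target_mem_nhds p)
    filter_upwards [ht] with t ht
    exact (extChartAt (modelCoT E) p).right_inv ht

end Multipliers

/-! ### Existence and smoothness of the multipliers, and the differentiated identity. -/

section Proposition

variable {E : Type*} [NormedAddCommGroup E] [NormedSpace ℝ E] [FiniteDimensional ℝ E]
  {Q : Type*} [TopologicalSpace Q] [ChartedSpace E Q] [IsManifold 𝓘(ℝ, E) ∞ Q]
  {L : TangentBundle 𝓘(ℝ, E) Q → ℝ} {U : Set (CotangentBundle E Q)}
  {ι : Type*} [Fintype ι] {φ : ι → CotangentBundle E Q → ℝ}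

theorem add_sum_smul_comp_add_sum_smulRight_apply {V W : Type*}
    [AddCommGroup V] [Module ℝ V] [TopologicalSpace V] [ContinuousAdd V]
    [ContinuousSMul ℝ V] [AddCommGroup W] [Module ℝ W] [TopologicalSpace W] (M : W →L[ℝ] V)
    (N : ι → W →L[ℝ] V) (l : ι → ℝ) (K : V →L[ℝ] W) (d : ι → V →L[ℝ] ℝ) (g : ι → V) (b : V) :
    ((M + ∑ μ, l μ • N μ) ∘L K + ∑ μ, (d μ).smulRight (g μ)) b =
      M (K b) + ∑ μ, l μ • N μ (K b) + ∑ μ, d μ b • g μ := by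
  simp

/-- The vectors `γ_μ(v)` are linearly independent and span the annihilator of the image of the
hessian, so that `v - γ_H(v)` is a linear combination of them. -/
theorem linearIndependent_gam_and_exists_coeff (hL : AlmostRegular L) (hU : IsOpen U)
    (hφ : IsIndependentPrimaryConstraints L U φ) {H : CotangentBundle E Q → ℝ}
    (hH : IsHamiltonian L U H) {q : Q} {u : E} (hv : legendre L ⟨q, u⟩ ∈ U) :
    LinearIndependent ℝ (fun μ => fibreDCoT (φ μ) q (fibreDT L q u)) ∧
      ∃ c : ι → ℝ, u = fibreDCoT H q (fibreDT L q u) +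
        ∑ μ, c μ • fibreDCoT (φ μ) q (fibreDT L q u) := by
  let v₀ : TangentBundle 𝓘(ℝ, E) Q := ⟨q, u⟩
  let p₀ : CotangentBundle E Q := legendre L v₀
  let x₀ : E := extChartAt 𝓘(ℝ, E) q q
  let a₀ : E →L[ℝ] ℝ := fibreDT L q u
  let z₀ : E × E := (x₀, u)
  have hz₀ : extChartAt (modelT E) v₀ v₀ = z₀ := extChartAt_tangent_fibre v₀ u
  have hp₀ : extChartAt (modelCoT E) p₀ p₀ = (x₀, a₀) := extChartAt_cotangent_fibre p₀ a₀
  have hpr : p₀ ∈ range (legendre L) := mem_range_self _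
  have hF₀ : locF v₀ L z₀ = (x₀, a₀) := by
    rw [← hz₀, ← extChartAt_legendre v₀ L (mem_chart_source E q), hp₀]
  have hsm : ∀ μ, ContMDiffAt (modelCoT E) 𝓘(ℝ, ℝ) ∞ (φ μ) p₀ := fun μ =>
    (hφ.smooth μ).contMDiffAt (hU.mem_nhds hv)
  have hloc : ∀ μ, DifferentiableAt ℝ (locC p₀ (φ μ)) (x₀, a₀) := fun μ => by
    rw [← hp₀]
    exact (contDiffAt_locC (mem_chart_source E q) (hsm μ)).differentiableAt (by simp)
  have hFd : DifferentiableAt ℝ (locF v₀ L) z₀ := by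
    rw [← hz₀]
    exact (contDiffAt_locF (hL.smooth v₀)).differentiableAt (by simp)
  -- In coordinates `B μ` is `dφ_μ` and `A` the fibre component of `dℱ`; the base component is the
  -- projection, as `ℱ` covers the identity.
  let B : ι → E × (E →L[ℝ] ℝ) →L[ℝ] ℝ := fun μ => fderiv ℝ (locC p₀ (φ μ)) (x₀, a₀)
  let A : E × E →L[ℝ] E →L[ℝ] ℝ := fderiv ℝ (fun z => (locF v₀ L z).2) z₀
  have hA : fderiv ℝ (locF v₀ L) z₀ = (ContinuousLinearMap.fst ℝ E E).prod A :=
    (hasFDerivAt_fst.prodMk hFd.snd.hasFDerivAt).fderiv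
  have hB : LinearIndependent ℝ B := by
    have h := hφ.independent p₀ hv hpr
    rwa [show (fun μ => mvfderiv (modelCoT E) (φ μ) p₀) = B from
      funext fun μ => (mvfderiv_eq_fderiv_locC (hsm μ)).trans (by rw [hp₀])] at h
  -- This is the derivative of `φ_μ ∘ ℱ = 0`, valid near `v₀`.
  have hBA : ∀ μ z, B μ (z.1, A z) = 0 := by
    intro μ z
    have hUev : ∀ᶠ y in 𝓝 z₀, legendre L ((extChartAt (modelT E) v₀).symm y) ∈ U := by
      have hc : ContinuousAt (extChartAt (modelT E) v₀).symm z₀ := by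
        rw [← hz₀]; exact continuousAt_extChartAt_symm v₀
      have hs : (extChartAt (modelT E) v₀).symm z₀ = v₀ := by
        rw [← hz₀]; exact (extChartAt (modelT E) v₀).left_inv (mem_extChartAt_source v₀)
      have hn : legendre L ⁻¹' U ∈ 𝓝 ((extChartAt (modelT E) v₀).symm z₀) := by
        rw [hs]
        exact (hU.preimage (contMDiff_legendre hL.smooth).continuous).mem_nhds hv
      exact hc.eventually_mem hn
    have hzero : (locC p₀ (φ μ) ∘ locF v₀ L) =ᶠ[𝓝 z₀] fun _ => 0 := by
      filter_upwards [hUev, hz₀ ▸ eventually_symm_mem_chart_source v₀] with y hyU hy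
      have h1 := extChartAt_legendre v₀ L hy.2
      rw [(extChartAt (modelT E) v₀).right_inv hy.1] at h1
      have h2 := (extChartAt (modelCoT E) p₀).left_inv (mem_extChartAt_cotangent_source
        (p₀ := p₀) (p := legendre L ((extChartAt (modelT E) v₀).symm y)) hy.2)
      rw [Function.comp_apply, ← h1, locC, h2]
      exact (hφ.mem_range_iff _ hyU).1 (mem_range_self _) μ
    have hcomp : HasFDerivAt (locC p₀ (φ μ) ∘ locF v₀ L) (B μ ∘L fderiv ℝ (locF v₀ L) z₀) z₀ :=
      HasFDerivAt.comp z₀ (by rw [hF₀]; exact (hloc μ).hasFDerivAt) hFd.hasFDerivAt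
    have h := DFunLike.congr_fun
      (hcomp.unique ((hasFDerivAt_const (0 : ℝ) z₀).congr_of_eventuallyEq hzero)) z
    rw [hA] at h
    exact h
  have hlift : ∀ z, (∀ μ, B μ z = 0) → ∃ y, (y.1, A y) = z := by
    intro z hz
    have h1 : z ∈ tangentTo (modelCoT E) (range (legendre L)) p₀ :=
      mem_tangentTo_range_legendre hU hφ hv hpr fun μ => by rw [hp₀]; exact hz μ
    rw [← hL.submersion v₀, mfderiv_legendre hL.smooth v₀, hz₀, hA] at h1
    exact h1
  -- On vertical vectors `dφ_μ` is evaluation at `γ_μ`, and (`hAinr`) `A` is the hessian.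
  have hBinr : ∀ μ y, B μ (0, y) = y (fibreDCoT (φ μ) q a₀) := by
    intro μ y
    rw [apply_fibreDCoT]
    have h := DFunLike.congr_fun (partial_fderiv_apply (hloc μ)) y
    refine h.symm.trans ?_
    exact congrArg (fun f => fderiv ℝ f a₀ y) (funext fun b => locC_fibre p₀ (φ μ) b)
  have hAinr : ∀ b, A (0, b) = fderiv ℝ (fibreDT L q) u b := by
    intro b
    have h := partial_fderiv_apply (z := z₀) hFd.snd
    have h2 : (fun w => (locF v₀ L (z₀.1, w)).2) = fibreDT L q := funext fun w =>
      congrArg (fun f => fderiv ℝ f w) (funext fun w' => locT_fibre v₀ L w')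
    rw [h2] at h
    exact (DFunLike.congr_fun h b).symm
  refine ⟨linearIndependent_of_eval (r := fun y => y) hBinr (linearIndependent_comp_inr hB hBA), ?_⟩
  obtain ⟨c, hc⟩ := exists_coeff_of_forall_eval_eq_zero
    (g := fun μ => fibreDCoT (φ μ) q a₀) (e := u - fibreDCoT H q a₀) fun y hy => by
      -- The lift of a vertical vector is vertical, so `y` is in the image of the hessian.
      obtain ⟨⟨x, b⟩, hxb⟩ := hlift (0, y) fun μ => (hBinr μ y).trans (hy μ)
      obtain ⟨hx, hb⟩ := Prod.mk.inj hxb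
      simp only at hx
      subst hx
      rw [← hb, hAinr]
      exact fderiv_fibreDT_apply_sub hL.smooth hU hH hv b
  exact ⟨c, (eq_add_of_sub_eq hc).trans (add_comm _ _)⟩

/-- The multipliers are smooth, being the coefficients of a smooth map in a smooth independent
family. -/
theorem contMDiffAt_multipliers (hL : AlmostRegular L) (hU : IsOpen U)
    (hφ : IsIndependentPrimaryConstraints L U φ) {H : CotangentBundle E Q → ℝ}
    (hH : IsHamiltonian L U H) {lam : ι → TangentBundle 𝓘(ℝ, E) Q → ℝ}
    (hlam : ∀ v ∈ legendre L ⁻¹' U, v.2 = gam L H v + ∑ μ, lam μ v • gam L (φ μ) v)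
    {v₀ : TangentBundle 𝓘(ℝ, E) Q} (hv : v₀ ∈ legendre L ⁻¹' U) (μ : ι) :
    ContMDiffAt (modelT E) 𝓘(ℝ, ℝ) ∞ (lam μ) v₀ := by
  have hopen : IsOpen (legendre L ⁻¹' U) :=
    hU.preimage (contMDiff_legendre hL.smooth).continuous
  have hcoord : ∀ v ∈ legendre L ⁻¹' U, v.1 ∈ (chartAt E v₀.1).source →
      (extChartAt (modelT E) v₀ v).2 - locGam v₀ L H (extChartAt (modelT E) v₀ v) =
        ∑ μ, lam μ v • locGam v₀ L (φ μ) (extChartAt (modelT E) v₀ v) := by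
    intro v hvU hvs
    have h := congrArg (coordEquiv v₀.1 v.1 hvs) (hlam v hvU)
    rw [map_add, map_sum] at h
    simp only [map_smul, coordEquiv_gam] at h
    have h2 := congrArg Prod.snd (extChartAt_tangent_apply v₀ v hvs)
    rw [h2, sub_eq_iff_eq_add']
    exact h
  have hc : ContinuousAt (extChartAt (modelT E) v₀).symm (extChartAt (modelT E) v₀ v₀) :=
    continuousAt_extChartAt_symm v₀
  have hs : (extChartAt (modelT E) v₀).symm (extChartAt (modelT E) v₀ v₀) = v₀ :=
    (extChartAt (modelT E) v₀).left_inv (mem_extChartAt_source v₀)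
  have hflat : ContDiffAt ℝ ∞ (fun z μ => locT v₀ (lam μ) z) (extChartAt (modelT E) v₀ v₀) := by
    refine contDiffAt_coeff_of_linearIndependent (g := fun μ => locGam v₀ L (φ μ))
      (s := fun z => z.2 - locGam v₀ L H z)
      (fun μ => contDiffAt_locGam (hL.smooth v₀)
        ((hφ.smooth μ).contMDiffAt (hU.mem_nhds hv)))
      (contDiffAt_snd.sub (contDiffAt_locGam (hL.smooth v₀)
        (hH.smooth.contMDiffAt (hU.mem_nhds hv)))) ?_ ?_
    -- Independence is needed only at `v₀`, where the coordinate expressions are the `γ_μ(v₀)`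
    -- themselves.
    · have h := (linearIndependent_gam_and_exists_coeff hL hU hφ hH hv).1
      convert h using 2 with μ
      exact locGam_self v₀ L (φ μ)
    · have hUev := hc.eventually_mem (by rw [hs]; exact hopen.mem_nhds hv)
      filter_upwards [hUev, eventually_symm_mem_chart_source v₀] with z hzU hz
      have h := hcoord _ hzU hz.2
      rwa [(extChartAt (modelT E) v₀).right_inv hz.1] at h
  have h1 : ContMDiffAt (modelT E) 𝓘(ℝ, E × E) ∞ (extChartAt (modelT E) v₀) v₀ :=
    contMDiffAt_extChartAt
  refine ((contDiffAt_pi.1 hflat μ).contMDiffAt.comp v₀ h1).congr_of_eventuallyEq ?_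
  filter_upwards [extChartAt_source_mem_nhds (I := modelT E) v₀] with v hv
  rw [Function.comp_apply, locT, (extChartAt (modelT E) v₀).left_inv hv]

/-- Differentiating `Id = γ_H + ∑_μ γ_μ λ^μ` along the fibre. -/
theorem id_eq_of_eventually_fibre {q : Q} {u : E}
    {H : CotangentBundle E Q → ℝ} {lam : ι → TangentBundle 𝓘(ℝ, E) Q → ℝ}
    (hL : ContMDiff (modelT E) 𝓘(ℝ, ℝ) ∞ L)
    (hφ : ∀ μ, ContMDiffAt (modelCoT E) 𝓘(ℝ, ℝ) ∞ (φ μ) (legendre L ⟨q, u⟩))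
    (hH : ContMDiffAt (modelCoT E) 𝓘(ℝ, ℝ) ∞ H (legendre L ⟨q, u⟩))
    (hlam : ∀ μ, ContMDiffAt (modelT E) 𝓘(ℝ, ℝ) ∞ (lam μ) ⟨q, u⟩)
    (heq : ∀ᶠ w : E in 𝓝 u, w = fibreDCoT H q (fibreDT L q w) +
      ∑ μ, lam μ ⟨q, w⟩ • fibreDCoT (φ μ) q (fibreDT L q w)) :
    ∀ b : E, b = fderiv ℝ (fibreDCoT H q) (fibreDT L q u) (fderiv ℝ (fibreDT L q) u b) +
      ∑ μ, lam μ ⟨q, u⟩ •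
        fderiv ℝ (fibreDCoT (φ μ) q) (fibreDT L q u) (fderiv ℝ (fibreDT L q) u b) +
      ∑ μ, fibreDT (lam μ) q u b • fibreDCoT (φ μ) q (fibreDT L q u) := by
  intro b
  have hl : HasFDerivAt (fibreDT L q) (fderiv ℝ (fibreDT L q) u) u :=
    ((contDiffAt_fibreDT (hL ⟨q, u⟩)).differentiableAt (by simp)).hasFDerivAt
  have hg : ∀ h : CotangentBundle E Q → ℝ,
      ContMDiffAt (modelCoT E) 𝓘(ℝ, ℝ) ∞ h (legendre L ⟨q, u⟩) →
      HasFDerivAt (fun w => fibreDCoT h q (fibreDT L q w))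
        (fderiv ℝ (fibreDCoT h q) (fibreDT L q u) ∘L fderiv ℝ (fibreDT L q) u) u := fun h hh =>
    HasFDerivAt.comp u (g := fibreDCoT h q)
      ((contDiffAt_fibreDCoT hh).differentiableAt (by simp)).hasFDerivAt hl
  have hlam' : ∀ μ, HasFDerivAt (fun w : E => lam μ ⟨q, w⟩) (fibreDT (lam μ) q u) u := fun μ =>
    ((contDiffAt_fibreT (hlam μ)).differentiableAt (by simp)).hasFDerivAt
  have hsum := (hg H hH).add
    (HasFDerivAt.fun_sum (u := Finset.univ) fun μ _ => (hlam' μ).fun_smul (hg (φ μ) (hφ μ)))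
  have h := (hasFDerivAt_id u).unique (hsum.congr_of_eventuallyEq heq)
  have hb := DFunLike.congr_fun h b
  simpa [Finset.sum_add_distrib, add_assoc] using hb

/-- Passes from operators on tangent spaces to derivatives on `E`; as each `T_q Q` is `E` by
definition, the two agree by unfolding. -/
theorem opM_comp_hessian_add_sum_apply {E : Type*} [NormedAddCommGroup E] [NormedSpace ℝ E]
    [FiniteDimensional ℝ E] {Q : Type*} [TopologicalSpace Q] [ChartedSpace E Q]
    {L : TangentBundle 𝓘(ℝ, E) Q → ℝ} {φ : ι → CotangentBundle E Q → ℝ} (H : CotangentBundle E Q → ℝ)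
    (lam : ι → TangentBundle 𝓘(ℝ, E) Q → ℝ) (v : TangentBundle 𝓘(ℝ, E) Q)
    (b : TangentSpace 𝓘(ℝ, E) v.1) :
    (opM L H φ lam v ∘L hessian L v + ∑ μ, (DT (lam μ) v).smulRight (gam L (φ μ) v)) b =
      fderiv ℝ (fibreDCoT H v.1) (fibreDT L v.1 v.2) (fderiv ℝ (fibreDT L v.1) v.2 b) +
      ∑ μ, lam μ v •
        fderiv ℝ (fibreDCoT (φ μ) v.1) (fibreDT L v.1 v.2) (fderiv ℝ (fibreDT L v.1) v.2 b) +
      ∑ μ, fibreDT (lam μ) v.1 v.2 b • fibreDCoT (φ μ) v.1 (fibreDT L v.1 v.2) := by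
  let D (h : CotangentBundle E Q → ℝ) : CotangentSpace E v.1 →L[ℝ] TangentSpace 𝓘(ℝ, E) v.1 :=
    D2CoT h (legendre L v)
  have h := add_sum_smul_comp_add_sum_smulRight_apply (D H) (fun μ => D (φ μ)) (fun μ => lam μ v)
    (hessian L v) (fun μ => DT (lam μ) v) (fun μ => gam L (φ μ) v) b
  exact h

end Proposition

end FibreDer

theorem proposition4
    {E : Type*} [NormedAddCommGroup E] [NormedSpace ℝ E] [FiniteDimensional ℝ E]
    {Q : Type*} [TopologicalSpace Q] [ChartedSpace E Q] [IsManifold 𝓘(ℝ, E) ∞ Q]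
    (L : TangentBundle 𝓘(ℝ, E) Q → ℝ) (hL : AlmostRegular L)
    (U : Set (CotangentBundle E Q)) (hU : IsOpen U)
    {ι : Type*} [Fintype ι] (φ : ι → CotangentBundle E Q → ℝ)
    (hφ : IsIndependentPrimaryConstraints L U φ)
    (H : CotangentBundle E Q → ℝ) (hH : IsHamiltonian L U H) :
    IsOpen (legendre L ⁻¹' U) ∧
    ∃ lam : ι → TangentBundle 𝓘(ℝ, E) Q → ℝ,
      (∀ μ, ContMDiffOn (modelT E) 𝓘(ℝ, ℝ) ∞ (lam μ) (legendre L ⁻¹' U)) ∧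
      (∀ v ∈ legendre L ⁻¹' U, v.2 = gam L H v + ∑ μ, lam μ v • gam L (φ μ) v) ∧
      (∀ v ∈ legendre L ⁻¹' U,
        ContinuousLinearMap.id ℝ (TangentSpace 𝓘(ℝ, E) v.1) =
          opM L H φ lam v ∘L hessian L v +
            ∑ μ, (DT (lam μ) v).smulRight (gam L (φ μ) v)) := by
  have hopen : IsOpen (legendre L ⁻¹' U) :=
    hU.preimage (contMDiff_legendre hL.smooth).continuous
  have hex : ∀ v : TangentBundle 𝓘(ℝ, E) Q, ∃ c : ι → ℝ, v ∈ legendre L ⁻¹' U →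
      v.2 = gam L H v + ∑ μ, c μ • gam L (φ μ) v := by
    intro v
    by_cases hv : v ∈ legendre L ⁻¹' U
    · obtain ⟨c, hc⟩ := (linearIndependent_gam_and_exists_coeff hL hU hφ hH hv).2
      exact ⟨c, fun _ => hc⟩
    -- The value outside the open set `ℱ⁻¹(U)` is arbitrary.
    · exact ⟨0, fun h => absurd h hv⟩
  choose c hc using hex
  have hsm : ∀ v ∈ legendre L ⁻¹' U, ∀ μ,
      ContMDiffAt (modelT E) 𝓘(ℝ, ℝ) ∞ (fun v => c v μ) v := fun v hv μ =>
    contMDiffAt_multipliers hL hU hφ hH (lam := fun μ v => c v μ) hc hv μ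
  refine ⟨hopen, fun μ v => c v μ, fun μ v hv => (hsm v hv μ).contMDiffWithinAt, hc, ?_⟩
  rintro ⟨q, u⟩ hv
  -- The first identity holds on a neighbourhood of `u` in its fibre, so it may be differentiated
  -- there.
  have h := id_eq_of_eventually_fibre hL.smooth
    (fun μ => (hφ.smooth μ).contMDiffAt (hU.mem_nhds hv))
    (hH.smooth.contMDiffAt (hU.mem_nhds hv)) (hsm _ hv) (by
      filter_upwards [eventually_fibre_mem hL.smooth hU hv] with w hw
      exact hc ⟨q, w⟩ hw)
  exact ContinuousLinearMap.ext fun b =>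
    (h b).trans (opM_comp_hessian_add_sum_apply H (fun μ v => c v μ) ⟨q, u⟩ b).symm
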